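/- Let $X$ be a real or complex Banach space which is $L$-embedded, i.e. there is a linear projection $P$ on the bidual $X^{**}$ whose range is (the canonical image of) $X$ and which satisfies $\|z\| = \|Pz\| + \|z - Pz\|$ for all $z \in X^{**}$; in other words $X^{**} = X \oplus_1 X^s$ with $X^s = \ker P$. Let $Y$ be a closed linear subspace of $X$ which is not reflexive. Then $T(Y) = 2$, where the thickness $T(Y)$ of $Y$ is $$T(Y) = \inf\{\varepsilon > 0 : \text{there is a finite set } F \subset S_Y \text{ such that for every } x \in S_Y \text{ there is } y \in F \text{ with } \|x - y\| \le \varepsilon\}$$ and $S_Y$ denotes the unit sphere of $Y$. -/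

import Mathlib

/-- A subspace `V` of a normed space `Z` is an `L`-summand if it is closed and it is the range of
an `L`-projection, i.e. of a linear map `P : Z → Z` with `P ∘ P = P` and
`‖z‖ = ‖P z‖ + ‖z - P z‖` for all `z : Z`. -/
def IsLSummand (𝕜 : Type*) {Z : Type*} [RCLike 𝕜] [NormedAddCommGroup Z] [NormedSpace 𝕜 Z]
    (V : Submodule 𝕜 Z) : Prop :=
  IsClosed (V : Set Z) ∧ ∃ P : Module.End 𝕜 Z, IsLprojection Z P ∧ LinearMap.range P = V

/-- A normed space is `L`-embedded if its canonical image in the bidual is an `L`-summand. -/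
def IsLEmbedded (𝕜 X : Type*) [RCLike 𝕜] [NormedAddCommGroup X] [NormedSpace 𝕜 X] : Prop :=
  IsLSummand 𝕜 (Z := StrongDual 𝕜 (StrongDual 𝕜 X))
    (LinearMap.range (NormedSpace.inclusionInDoubleDual 𝕜 X).toLinearMap)

/-- A normed space is reflexive if the canonical map into its topological bidual is onto. -/
def IsReflexiveSpace (𝕜 X : Type*) [RCLike 𝕜] [NormedAddCommGroup X] [NormedSpace 𝕜 X] : Prop :=
  Function.Surjective (NormedSpace.inclusionInDoubleDual 𝕜 X)

/-- `F` is an inner `ε`-net for the unit sphere of `X`. -/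
def IsInnerNet {X : Type*} [NormedAddCommGroup X] (ε : ℝ) (F : Set X) : Prop :=
  F ⊆ Metric.sphere (0 : X) 1 ∧ ∀ x ∈ Metric.sphere (0 : X) 1, ∃ y ∈ F, ‖x - y‖ ≤ ε

/-- The thickness of a normed space: the infimum of all `ε > 0` such that the unit sphere has a
finite inner `ε`-net. -/
noncomputable def thickness (X : Type*) [NormedAddCommGroup X] : ℝ :=
  sInf {ε : ℝ | 0 < ε ∧ ∃ F : Set X, F.Finite ∧ IsInnerNet ε F}

/-!
Let `J` be the canonical embedding of `X` into its bidual, and let `Y` be a closed non-reflexive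
subspace of `X`. An element of the bidual of `Y` that does not come from `Y` pushes forward to an
element `z` of `X**` that vanishes on the annihilator of `Y` and does not lie in `J Y`. The
`L`-projection splits it as `z = J x₀ + s`, where `σ := ‖s‖ > 0` because `Y` is closed, and
`‖J w + s‖ = ‖w‖ + σ` for all `w : X`.

The point `x₀` need not belong to `Y`, so `s` itself is not approximated from `Y`. But `Y` contains
points `y` such that `u = y - x₀` imitates `s` on any given finite set of functionals and has norm
nearly `σ` (`exists_mem_norm_sub_lt`, a form of Helly's theorem). Testing on almost norming
functionals, such a `u` is nearly `L`-orthogonal to any given finite set of vectors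
(`exists_mem_almost_orthogonal`). Of two such points `y₁`, `y₂`, the second chosen after the first,
the difference lies in `Y`, the unwanted `x₀` cancels, and
`‖w + (y₂ - y₁)‖ ≈ ‖w‖ + 2σ`, `‖y₂ - y₁‖ ≈ 2σ` for the finitely many prescribed vectors `w`
(`exists_mem_norm_lt_of_sub_lt`). Taking `w = -2σy` for `y` in a finite subset `F` of the unit
sphere and normalizing `y₂ - y₁` gives a point of the unit sphere of `Y` at distance
almost `2` from all of `F`.
-/

open NormedSpace

section

variable {𝕜 X : Type*} [RCLike 𝕜] [NormedAddCommGroup X] [NormedSpace 𝕜 X]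

/-! ### Functionals vanishing on a subspace -/

/-- The distance from `p` to a subspace is attained by a functional vanishing on the subspace. -/
lemma exists_dual_eq_norm_quotient_mk (N : Submodule 𝕜 X) (p : X) :
    ∃ g : StrongDual 𝕜 X, ‖g‖ ≤ 1 ∧ (∀ n ∈ N, g n = 0) ∧
      g p = (‖(Submodule.Quotient.mk p : X ⧸ N)‖ : ℝ) := by
  obtain ⟨g, hg, hgp⟩ := exists_dual_vector'' 𝕜 (Submodule.Quotient.mk p : X ⧸ N)
  have hb : ∀ x : X, ‖(g.toLinearMap ∘ₗ N.mkQ) x‖ ≤ 1 * ‖x‖ := fun x =>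
    (g.le_of_opNorm_le hg _).trans
      (mul_le_mul_of_nonneg_left (Submodule.Quotient.norm_mk_le N x) zero_le_one)
  refine ⟨(g.toLinearMap ∘ₗ N.mkQ).mkContinuous 1 hb,
    LinearMap.mkContinuous_norm_le _ zero_le_one hb, fun n hn => ?_, hgp⟩
  have : N.mkQ n = 0 := by simpa using hn
  exact (congrArg g this).trans (map_zero g)

/-- A bidual element that vanishes on the annihilator of `Y` is given on finitely many functionals
by evaluation at a point of `Y`. -/
lemma exists_mem_forall_apply_eq (Y : Submodule 𝕜 X) (z : StrongDual 𝕜 (StrongDual 𝕜 X))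
    (hz : ∀ g : StrongDual 𝕜 X, (∀ y ∈ Y, g y = 0) → z g = 0)
    {ι : Type*} [Finite ι] (f : ι → StrongDual 𝕜 X) : ∃ y ∈ Y, ∀ i, f i y = z (f i) := by
  classical
  have := Fintype.ofFinite ι
  let L : Y →ₗ[𝕜] (ι → 𝕜) := LinearMap.pi fun i => (f i).toLinearMap ∘ₗ Y.subtype
  suffices h : (fun i => z (f i)) ∈ LinearMap.range L by
    obtain ⟨y, hy⟩ := h
    exact ⟨y, y.2, fun i => congrFun hy i⟩
  by_contra h
  obtain ⟨φ, hφ, hφL⟩ := Submodule.exists_le_ker_of_notMem h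
  apply hφ
  have key := hz (∑ i, φ (fun j => if i = j then 1 else 0) • f i) fun y hy => by
    have h0 : φ (L ⟨y, hy⟩) = 0 := hφL ⟨_, rfl⟩
    rw [LinearMap.pi_apply_eq_sum_univ] at h0
    simpa [L, mul_comm] using h0
  rw [LinearMap.pi_apply_eq_sum_univ]
  simpa [mul_comm] using key

/-- Helly's theorem relative to a subspace and a base point: the point of `Y` that represents `z`
on finitely many functionals can be chosen almost as close to `x₀` as `z` is. -/
lemma exists_mem_norm_sub_lt (Y : Submodule 𝕜 X) (z : StrongDual 𝕜 (StrongDual 𝕜 X))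
    (hz : ∀ g : StrongDual 𝕜 X, (∀ y ∈ Y, g y = 0) → z g = 0) (x₀ : X)
    {ι : Type*} [Finite ι] (f : ι → StrongDual 𝕜 X) {r : ℝ}
    (hr : ‖z - inclusionInDoubleDual 𝕜 X x₀‖ < r) :
    ∃ y ∈ Y, (∀ i, f i y = z (f i)) ∧ ‖y - x₀‖ < r := by
  obtain ⟨y₀, hy₀, hfy₀⟩ := exists_mem_forall_apply_eq Y z hz f
  -- All points of `Y` representing `z` on the `f i` form the coset `y₀ + N`.
  let N : Submodule 𝕜 X := Y ⊓ ⨅ i, LinearMap.ker (f i).toLinearMap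
  have hN : ∀ n, n ∈ N ↔ n ∈ Y ∧ ∀ i, f i n = 0 := fun n => by simp [N]
  obtain ⟨g, hg1, hgN, hgp⟩ := exists_dual_eq_norm_quotient_mk N (y₀ - x₀)
  -- A functional vanishing on `N` agrees on `Y` with a combination of the `f i`, so `g y₀ = z g`.
  have hgz : g y₀ = z g := by
    have hspan : g.toLinearMap ∘ₗ Y.subtype ∈
        Submodule.span 𝕜 (Set.range fun i => (f i).toLinearMap ∘ₗ Y.subtype) := by
      refine mem_span_of_iInf_ker_le_ker fun y hy => ?_
      refine hgN _ ((hN _).2 ⟨y.2, fun i => ?_⟩)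
      exact (Submodule.mem_iInf _).1 hy i
    have := Fintype.ofFinite ι
    obtain ⟨c, hc⟩ := (Submodule.mem_span_range_iff_exists_fun 𝕜).1 hspan
    have hc' : ∀ y ∈ Y, ∑ i, c i * f i y = g y := fun y hy => by
      simpa using LinearMap.congr_fun hc ⟨y, hy⟩
    have h := hz (g - ∑ i, c i • f i) fun y hy => by simp [← hc' y hy]
    rw [map_sub, sub_eq_zero] at h
    rw [h, ← hc' y₀ hy₀]
    simp [hfy₀]
  have hlt : ‖(Submodule.Quotient.mk (y₀ - x₀) : X ⧸ N)‖ < r := by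
    refine lt_of_le_of_lt ?_ hr
    have h1 : (z - inclusionInDoubleDual 𝕜 X x₀) g =
        (‖(Submodule.Quotient.mk (y₀ - x₀) : X ⧸ N)‖ : ℝ) := by
      rw [← hgp]; simp [hgz]
    have h2 := (z - inclusionInDoubleDual 𝕜 X x₀).unit_le_opNorm g hg1
    rwa [h1, RCLike.norm_ofReal, abs_norm] at h2
  obtain ⟨m, hm, hmr⟩ := Submodule.Quotient.norm_mk_lt
    (Submodule.Quotient.mk (y₀ - x₀) : X ⧸ N) (sub_pos.2 hlt)
  rw [add_sub_cancel] at hmr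
  have hmN := (hN _).1 ((Submodule.Quotient.eq N).1 hm)
  refine ⟨x₀ + m, ?_, fun i => ?_, by simpa using hmr⟩
  · have := Y.add_mem hmN.1 hy₀
    convert this using 1
    abel
  · have := hmN.2 i
    simp only [map_sub] at this
    rw [map_add, ← hfy₀ i]
    linear_combination this

/-- If `z - J x₀` is `L`-orthogonal to every `J w`, then some `y ∈ Y` has the property that
`y - x₀` is almost `L`-orthogonal to the vectors of a given finite set. -/
lemma exists_mem_almost_orthogonal (Y : Submodule 𝕜 X) (z : StrongDual 𝕜 (StrongDual 𝕜 X))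
    (hz : ∀ g : StrongDual 𝕜 X, (∀ y ∈ Y, g y = 0) → z g = 0) (x₀ : X)
    (horth : ∀ w, ‖inclusionInDoubleDual 𝕜 X w + (z - inclusionInDoubleDual 𝕜 X x₀)‖ =
      ‖w‖ + ‖z - inclusionInDoubleDual 𝕜 X x₀‖)
    {W : Set X} (hW : W.Finite) {δ : ℝ} (hδ : 0 < δ) :
    ∃ y ∈ Y, ‖y - x₀‖ < ‖z - inclusionInDoubleDual 𝕜 X x₀‖ + δ ∧
      ∀ w ∈ W, ‖w‖ + ‖z - inclusionInDoubleDual 𝕜 X x₀‖ - δ < ‖w + (y - x₀)‖ := by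
  have hnorming : ∀ w : X, ∃ g : StrongDual 𝕜 X, ‖g‖ < 1 ∧
      ‖w‖ + ‖z - inclusionInDoubleDual 𝕜 X x₀‖ - δ <
        ‖(inclusionInDoubleDual 𝕜 X w + (z - inclusionInDoubleDual 𝕜 X x₀)) g‖ := fun w =>
    ContinuousLinearMap.exists_lt_apply_of_lt_opNorm _ (by rw [horth]; linarith)
  choose g hg1 hg using hnorming
  have := hW.to_subtype
  obtain ⟨y, hy, hgy, hyx⟩ := exists_mem_norm_sub_lt Y z hz x₀ (fun w : W => g w)
    (lt_add_of_pos_right _ hδ)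
  refine ⟨y, hy, hyx, fun w hw => (hg w).trans_le ?_⟩
  have h : (inclusionInDoubleDual 𝕜 X w + (z - inclusionInDoubleDual 𝕜 X x₀)) (g w) =
      g w (w + (y - x₀)) := by
    simp [hgy ⟨w, hw⟩]
  rw [h]
  exact ((g w).le_of_opNorm_le (hg1 w).le _).trans_eq (one_mul _)

/-- The difference of two consecutively chosen points of `Y` does not see the base point `x₀`,
and is almost `L`-orthogonal to the vectors of a given finite set. -/
lemma exists_mem_norm_lt_of_sub_lt (Y : Submodule 𝕜 X) (z : StrongDual 𝕜 (StrongDual 𝕜 X))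
    (hz : ∀ g : StrongDual 𝕜 X, (∀ y ∈ Y, g y = 0) → z g = 0) (x₀ : X)
    (horth : ∀ w, ‖inclusionInDoubleDual 𝕜 X w + (z - inclusionInDoubleDual 𝕜 X x₀)‖ =
      ‖w‖ + ‖z - inclusionInDoubleDual 𝕜 X x₀‖)
    {W : Set X} (hW : W.Finite) {δ : ℝ} (hδ : 0 < δ) :
    ∃ v ∈ Y, ‖v‖ < 2 * ‖z - inclusionInDoubleDual 𝕜 X x₀‖ + δ ∧
      ∀ w ∈ W, ‖w‖ + 2 * ‖z - inclusionInDoubleDual 𝕜 X x₀‖ - δ < ‖w + v‖ := by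
  obtain ⟨y₁, hy₁, hyx₁, h₁⟩ := exists_mem_almost_orthogonal Y z hz x₀ horth
    (hW.image fun w => -w) (half_pos hδ)
  obtain ⟨y₂, hy₂, hyx₂, h₂⟩ := exists_mem_almost_orthogonal Y z hz x₀ horth
    (hW.image fun w => w - (y₁ - x₀)) (half_pos hδ)
  have hv : y₂ - y₁ = (y₂ - x₀) - (y₁ - x₀) := by abel
  refine ⟨y₂ - y₁, Y.sub_mem hy₂ hy₁, ?_, fun w hw => ?_⟩
  · rw [hv]
    linarith [norm_sub_le (y₂ - x₀) (y₁ - x₀)]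
  · have e₁ := h₁ _ ⟨w, hw, rfl⟩
    have e₂ := h₂ _ ⟨w, hw, rfl⟩
    have n₁ : ‖-w + (y₁ - x₀)‖ = ‖w - (y₁ - x₀)‖ := by rw [← norm_neg]; congr 1; abel
    have n₂ : w - (y₁ - x₀) + (y₂ - x₀) = w + (y₂ - y₁) := by abel
    simp only [norm_neg, n₁] at e₁
    simp only [n₂] at e₂
    linarith

/-! ### Non-reflexive subspaces of `L`-embedded spaces -/

lemma IsLprojection.norm_add_sub_apply {Z : Type*} [NormedAddCommGroup Z] [NormedSpace 𝕜 Z]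
    {P : Module.End 𝕜 Z} (hP : IsLprojection Z P) {u : Z} (hu : u ∈ LinearMap.range P) (z : Z) :
    ‖u + (z - P z)‖ = ‖u‖ + ‖z - P z‖ := by
  obtain ⟨a, rfl⟩ := hu
  have hPP : ∀ t, P (P t) = P t := fun t => LinearMap.congr_fun hP.proj t
  have h : P (P a + (z - P z)) = P a := by simp [hPP]
  rw [hP.Lnorm, sub_smul, one_smul, Module.End.smul_def, h, add_sub_cancel_left]

/-- A closed non-reflexive subspace `Y` of an `L`-embedded space has a weak* limit `z` in the
bidual whose component in the complementary `L`-summand is non-zero. -/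
lemma IsLEmbedded.exists_singular_part (hX : IsLEmbedded 𝕜 X) (Y : Submodule 𝕜 X)
    (hYclosed : IsClosed (Y : Set X)) (hY : ¬ IsReflexiveSpace 𝕜 Y) :
    ∃ (z : StrongDual 𝕜 (StrongDual 𝕜 X)) (x₀ : X),
      (∀ g : StrongDual 𝕜 X, (∀ y ∈ Y, g y = 0) → z g = 0) ∧
      0 < ‖z - inclusionInDoubleDual 𝕜 X x₀‖ ∧
      ∀ w, ‖inclusionInDoubleDual 𝕜 X w + (z - inclusionInDoubleDual 𝕜 X x₀)‖ =
        ‖w‖ + ‖z - inclusionInDoubleDual 𝕜 X x₀‖ := by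
  obtain ⟨-, P, hP, hrange⟩ := hX
  simp only [IsReflexiveSpace, Function.Surjective, not_forall, not_exists] at hY
  obtain ⟨ζ, hζ⟩ := hY
  let R : StrongDual 𝕜 X →L[𝕜] StrongDual 𝕜 Y := ContinuousLinearMap.precomp 𝕜 Y.subtypeL
  let z : StrongDual 𝕜 (StrongDual 𝕜 X) := ζ.comp R
  have hz : ∀ g : StrongDual 𝕜 X, (∀ y ∈ Y, g y = 0) → z g = 0 := fun g hg => by
    have : R g = 0 := by ext y; exact hg y y.2
    simp [z, this]
  obtain ⟨x₀, hx₀⟩ : ∃ x₀, inclusionInDoubleDual 𝕜 X x₀ = P z := by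
    have : P z ∈ LinearMap.range P := ⟨z, rfl⟩
    rwa [hrange] at this
  have hne : z - inclusionInDoubleDual 𝕜 X x₀ ≠ 0 := fun h0 => by
    have hzg : ∀ g, z g = g x₀ := fun g => sub_eq_zero.1 (DFunLike.congr_fun h0 g)
    have hx₀Y : x₀ ∈ Y := by
      obtain ⟨g, -, hgY, hg⟩ := exists_dual_eq_norm_quotient_mk Y x₀
      rw [← hzg, hz g hgY, eq_comm, RCLike.ofReal_eq_zero] at hg
      have := (QuotientAddGroup.norm_mk_eq_zero_iff_mem_closure (S := Y.toAddSubgroup)).1 hg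
      rwa [Submodule.coe_toAddSubgroup, hYclosed.closure_eq] at this
    refine hζ ⟨x₀, hx₀Y⟩ (ContinuousLinearMap.ext fun f => ?_)
    obtain ⟨g, hg, -⟩ := exists_extension_norm_eq Y f
    have hRg : R g = f := ContinuousLinearMap.ext hg
    have := hzg g
    rw [dual_def, ← hRg]
    exact this.symm
  refine ⟨z, x₀, hz, norm_pos_iff (E := StrongDual 𝕜 (StrongDual 𝕜 X)) |>.2 hne, fun w => ?_⟩
  have hw : inclusionInDoubleDual 𝕜 X w ∈ LinearMap.range P := by rw [hrange]; exact ⟨w, rfl⟩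
  rw [hx₀, hP.norm_add_sub_apply hw, show ‖inclusionInDoubleDual 𝕜 X w‖ = ‖w‖ from
    (inclusionInDoubleDualLi 𝕜).norm_map w]

end

/-! ### Thickness -/

theorem mainTheorem3 {𝕜 : Type*} [RCLike 𝕜] {X : Type*} [NormedAddCommGroup X]
    [NormedSpace 𝕜 X] [CompleteSpace X] (hX : IsLEmbedded 𝕜 X)
    (Y : Submodule 𝕜 X) (hYclosed : IsClosed (Y : Set X)) (hY : ¬ IsReflexiveSpace 𝕜 Y) :
    thickness Y = 2 := by
  obtain ⟨z, x₀, hz, hpos, horth⟩ := hX.exists_singular_part Y hYclosed hY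
  set σ := ‖z - inclusionInDoubleDual 𝕜 X x₀‖
  -- Any single unit vector is an inner `2`-net.
  have hmem : (2 : ℝ) ∈ {ε : ℝ | 0 < ε ∧ ∃ F : Set Y, F.Finite ∧ IsInnerNet ε F} := by
    obtain ⟨v, hv, -, hv'⟩ := exists_mem_norm_lt_of_sub_lt Y z hz x₀ horth
      (Set.finite_singleton 0) hpos
    have hv0 : (⟨v, hv⟩ : Y) ≠ 0 := by
      intro h
      have h' : v = 0 := congrArg Subtype.val h
      have := hv' 0 rfl
      rw [h', add_zero, norm_zero] at this
      linarith
    have hu : ‖((‖(⟨v, hv⟩ : Y)‖⁻¹ : ℝ) : 𝕜) • (⟨v, hv⟩ : Y)‖ = 1 := by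
      rw [RCLike.ofReal_inv]
      exact norm_smul_inv_norm hv0
    refine ⟨two_pos, {_}, Set.finite_singleton _,
      Set.singleton_subset_iff.2 (mem_sphere_zero_iff_norm.2 hu), fun x hx => ⟨_, rfl, ?_⟩⟩
    have := norm_sub_le x (((‖(⟨v, hv⟩ : Y)‖⁻¹ : ℝ) : 𝕜) • (⟨v, hv⟩ : Y))
    rw [mem_sphere_zero_iff_norm.1 hx, hu] at this
    linarith
  refine le_antisymm (csInf_le ⟨0, fun ε hε => hε.1.le⟩ hmem) (le_csInf ⟨2, hmem⟩ ?_)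
  rintro ε ⟨hε, F, hF, hFS, hnet⟩
  by_contra! hε2
  -- With this `δ`, the bound `(4σ - 2δ) / (2σ + δ)` obtained below exceeds `ε`.
  obtain ⟨δ, hδ, hδσ⟩ : ∃ δ > 0, δ * 4 < σ * (2 - ε) :=
    ⟨σ * (2 - ε) / 5, by have := sub_pos.2 hε2; positivity,
      by have := mul_pos hpos (sub_pos.2 hε2); linarith⟩
  -- The vector `0` is added to the test set to bound `‖v‖` from below.
  obtain ⟨v, hvY, hvlt, hv⟩ := exists_mem_norm_lt_of_sub_lt Y z hz x₀ horth
    ((hF.image fun y : Y => -(((2 * σ : ℝ) : 𝕜) • (y : X))).insert 0) hδ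
  have hv0 := hv 0 (Set.mem_insert _ _)
  rw [norm_zero, zero_add, zero_add] at hv0
  have hδ1 : δ < σ := by nlinarith
  have hvpos : 0 < ‖v‖ := by linarith
  let x : Y := ((‖v‖⁻¹ : ℝ) : 𝕜) • ⟨v, hvY⟩
  have hx : x ∈ Metric.sphere (0 : Y) 1 := by
    rw [mem_sphere_zero_iff_norm]
    simp only [x, norm_smul, RCLike.norm_ofReal, abs_inv, abs_norm]
    exact inv_mul_cancel₀ hvpos.ne'
  obtain ⟨y, hyF, hxy⟩ := hnet x hx
  have hy1 : ‖(y : X)‖ = 1 := mem_sphere_zero_iff_norm.1 (hFS hyF)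
  have hvy := hv _ (Set.mem_insert_of_mem _ ⟨y, hyF, rfl⟩)
  rw [norm_neg, norm_smul, hy1, RCLike.norm_ofReal, abs_of_pos (by positivity)] at hvy
  have hvx : v = ((‖v‖ : ℝ) : 𝕜) • (x : X) := by
    simp only [x, Submodule.coe_smul, smul_smul, ← RCLike.ofReal_mul]
    rw [mul_inv_cancel₀ hvpos.ne']
    simp
  have hsplit : -(((2 * σ : ℝ) : 𝕜) • (y : X)) + v =
      ((‖v‖ : ℝ) : 𝕜) • ((x : X) - y) + ((‖v‖ - 2 * σ : ℝ) : 𝕜) • (y : X) := by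
    nth_rewrite 1 [hvx]
    rw [RCLike.ofReal_sub, smul_sub, sub_smul]
    abel
  have hle : ‖-(((2 * σ : ℝ) : 𝕜) • (y : X)) + v‖ ≤ ‖v‖ * ε + |‖v‖ - 2 * σ| := by
    rw [hsplit]
    refine (norm_add_le _ _).trans (add_le_add ?_ ?_)
    · rw [norm_smul, RCLike.norm_ofReal, abs_norm]
      exact mul_le_mul_of_nonneg_left hxy hvpos.le
    · rw [norm_smul, hy1, RCLike.norm_ofReal, mul_one]
  have habs : |‖v‖ - 2 * σ| < δ := abs_lt.2 ⟨by linarith, by linarith⟩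
  have : ‖v‖ * ε ≤ (2 * σ + δ) * ε := mul_le_mul_of_nonneg_right hvlt.le hε.le
  nlinarith
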